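/- Let $P$ be a submonoid of a group $G$, with identity $e$. A word is a finite sequence $\alpha=(p_1,\dots,p_{2k})$ of even length ($k\ge 0$) in $P$; put $\dot\alpha=p_1^{-1}p_2\cdots p_{2k-1}^{-1}p_{2k}$ and call $\alpha$ neutral if $\dot\alpha=e$. Let $$K(\alpha)=P\cap p_{2k}^{-1}p_{2k-1}P\cap p_{2k}^{-1}p_{2k-1}p_{2k-2}^{-1}p_{2k-3}P\cap\dots\cap \dot\alpha^{-1}P$$ and let $\mathfrak J=\{K(\alpha)\}$, $\alpha$ ranging over all words, be the set of constructible right ideals of $P$. For a map $w$ from $P$ to a unital C*-algebra write $\dot w_\alpha=w_{p_1}^*w_{p_2}\cdots w_{p_{2k-1}}^*w_{p_{2k}}$. We say that $P$ satisfies independence if, for every nonempty finite $F\subset\mathfrak J$ with $\bigcup_{S\in F}S\in\mathfrak J$, one has $\bigcup_{S\in F}S\in F$. Consider the relations - (T1) $w_e=1$; - (T2) $\dot w_\alpha=0$ if $\alpha$ is neutral and $K(\alpha)=\emptyset$; - (T3) $\dot w_\alpha=\dot w_\beta$ if $\alpha,\beta$ are neutral and $K(\alpha)=K(\beta)$; -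 (T4) $\prod_{\beta\in F}(\dot w_\alpha-\dot w_\beta)=0$ if $\alpha$ is neutral and $F$ is a nonempty finite set of neutral words with $K(\alpha)=\bigcup_{\beta\in F}K(\beta)$. Let $\mathcal T_u(P)$ be the universal unital C*-algebra generated by elements $t_p$ ($p\in P$) subject to (T1)--(T4), and $\mathrm C^*_\#(P)$ the one generated by elements $w_p$ ($p\in P$) subject to (T1)--(T3). Let Li's semigroup C*-algebra $\mathrm C^*_s(P)$ be the universal unital C*-algebra generated by isometries $v_p$ ($p\in P$) and projections $e_S$ ($S\in\mathfrak J\cup\{\emptyset\}$) subject to $v_pv_q=v_{pq}$, $e_\emptyset=0$, and $\dot v_\alpha=e_S$ whenever $S\in\mathfrak J$ and $\alpha$ is a neutral word with $K(\alpha)=S$. Then the relations (T1)--(T3) alone present $\mathrm C^*_s(P)$: there is a $*$-isomorphism $\mathrm C^*_\#(P)\to\mathrm C^*_s(P)$ with $w_p\mapsto v_p$ for all $p\in P$. Moreover there is a unique unital $*$-homomorphism $\Lambda\colon\mathrm C^*_s(P)\to\mathcal T_u(P)$ with $\Lambda(v_p)=t_p$ for all $p\in P$; it is surjective, and it is an isomorphism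 if and only if $P$ satisfies independence. -/

import Mathlib

noncomputable section

/-! ### The free unital complex star-algebra -/

/-- The free unital complex star-algebra on `X`: the algebra of noncommutative polynomials in
letters `(x, false)`, standing for `x`, and `(x, true)`, standing for the adjoint of `x`. -/
abbrev FreeStarAlgebra (X : Type*) : Type _ := MonoidAlgebra ℂ (FreeMonoid (X × Bool))

namespace FreeStarAlgebra

/-- The generator of the free star-algebra attached to `x`. -/
def of {X : Type*} (x : X) : FreeStarAlgebra X := MonoidAlgebra.single (FreeMonoid.of (x, false)) 1

/-- The adjoint as an additive and multiplicative map into the opposite algebra: it conjugates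
coefficients, exchanges each letter with its adjoint, and reverses words. -/
def starHom (X : Type*) : FreeStarAlgebra X →+* (FreeStarAlgebra X)ᵐᵒᵖ :=
  MonoidAlgebra.liftNCRingHom
    ((algebraMap ℂ (FreeStarAlgebra X)ᵐᵒᵖ).comp (starRingEnd ℂ))
    (FreeMonoid.lift fun y => MulOpposite.op (MonoidAlgebra.single (FreeMonoid.of (y.1, !y.2)) 1))
    (fun c _ => Algebra.commute_algebraMap_left (A := (FreeStarAlgebra X)ᵐᵒᵖ) (starRingEnd ℂ c) _)

theorem induction {X : Type*} {motive : FreeStarAlgebra X → Prop}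
    (hscalar : ∀ c : ℂ, motive (algebraMap ℂ _ c))
    (hletter : ∀ y : X × Bool, motive (MonoidAlgebra.single (FreeMonoid.of y) 1))
    (hadd : ∀ a b, motive a → motive b → motive (a + b))
    (hmul : ∀ a b, motive a → motive b → motive (a * b)) (a : FreeStarAlgebra X) : motive a := by
  have hm : ∀ m : FreeMonoid (X × Bool), motive (MonoidAlgebra.single m 1) := by
    intro m
    induction m using FreeMonoid.inductionOn with
    | one => simpa using hscalar 1
    | of y => exact hletter y
    | mul a b ha hb =>
      have := hmul _ _ ha hb
      rw [MonoidAlgebra.single_mul_single] at this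
      simpa using this
  refine MonoidAlgebra.induction_on (motive := motive) a hm hadd ?_
  intro c f hf
  rw [Algebra.smul_def]
  exact hmul _ _ (hscalar c) hf

theorem starHom_algebraMap {X : Type*} (c : ℂ) :
    starHom X (algebraMap ℂ _ c) = MulOpposite.op (algebraMap ℂ _ (starRingEnd ℂ c)) := by
  have : (algebraMap ℂ (FreeStarAlgebra X) c) = MonoidAlgebra.single 1 c := rfl
  rw [this, starHom, MonoidAlgebra.liftNCRingHom_single]
  simp

theorem starHom_letter {X : Type*} (y : X × Bool) :
    starHom X (MonoidAlgebra.single (FreeMonoid.of y) 1) =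
      MulOpposite.op (MonoidAlgebra.single (FreeMonoid.of (y.1, !y.2)) 1) := by
  rw [starHom, MonoidAlgebra.liftNCRingHom_single, RingHom.map_one, one_mul]
  rfl

instance (X : Type*) : StarRing (FreeStarAlgebra X) where
  star a := (starHom X a).unop
  star_involutive a := by
    induction a using FreeStarAlgebra.induction with
    | hscalar c =>
      beta_reduce
      rw [starHom_algebraMap, MulOpposite.unop_op, starHom_algebraMap, MulOpposite.unop_op,
        Complex.conj_conj]
    | hletter y => simp [starHom_letter]
    | hadd a b ha hb => simp only [map_add, MulOpposite.unop_add, ha, hb]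
    | hmul a b ha hb => simp only [map_mul, MulOpposite.unop_mul, ha, hb]
  star_mul a b := by simp
  star_add a b := by simp

theorem star_eq {X : Type*} (a : FreeStarAlgebra X) : star a = (starHom X a).unop := rfl

theorem star_algebraMap {X : Type*} (c : ℂ) :
    star (algebraMap ℂ (FreeStarAlgebra X) c) = algebraMap ℂ _ (star c) := by
  rw [star_eq, starHom_algebraMap]; rfl

instance (X : Type*) : StarModule ℂ (FreeStarAlgebra X) where
  star_smul c a := by
    rw [Algebra.smul_def, star_mul, star_algebraMap, Algebra.smul_def, Algebra.commutes]

theorem single_true {X : Type*} (x : X) : MonoidAlgebra.single (FreeMonoid.of (x, true)) 1 = star (of x) := by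
  rw [of, star_eq, starHom_letter]; rfl

/-- The star-homomorphism out of the free star-algebra with prescribed values on the generators. -/
def lift {X A : Type*} [Ring A] [StarRing A] [Algebra ℂ A] [StarModule ℂ A] (w : X → A) :
    FreeStarAlgebra X →⋆ₐ[ℂ] A where
  __ : FreeStarAlgebra X →ₐ[ℂ] A := MonoidAlgebra.lift ℂ A (FreeMonoid (X × Bool))
    (FreeMonoid.lift fun y => if y.2 then star (w y.1) else w y.1)
  map_star' a := by
    set f : FreeStarAlgebra X →ₐ[ℂ] A := MonoidAlgebra.lift ℂ A (FreeMonoid (X × Bool))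
      (FreeMonoid.lift fun y => if y.2 then star (w y.1) else w y.1) with hf
    have hy : ∀ y : X × Bool, f (MonoidAlgebra.single (FreeMonoid.of y) 1) =
        if y.2 then star (w y.1) else w y.1 := by
      intro y
      rw [hf, MonoidAlgebra.lift_single]
      simp
    change f (star a) = star (f a)
    induction a using FreeStarAlgebra.induction with
    | hscalar c => rw [star_algebraMap, AlgHom.commutes, AlgHom.commutes, algebraMap_star_comm]
    | hletter y =>
      obtain ⟨x, b⟩ := y
      rw [star_eq, starHom_letter, MulOpposite.unop_op, hy, hy]
      cases b <;> simp
    | hadd a b ha hb => simp only [star_add, map_add, ha, hb]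
    | hmul a b ha hb => simp only [star_mul, map_mul, ha, hb]

theorem hom_ext {X A : Type*} [Ring A] [StarRing A] [Algebra ℂ A]
    {f g : FreeStarAlgebra X →⋆ₐ[ℂ] A} (h : ∀ x, f (of x) = g (of x)) : f = g := by
  refine StarAlgHom.ext fun a => ?_
  induction a using FreeStarAlgebra.induction with
  | hscalar c => rw [AlgHomClass.commutes, AlgHomClass.commutes]
  | hletter y =>
    obtain ⟨x, b⟩ := y
    cases b with
    | false => exact h x
    | true => rw [single_true, map_star, map_star, h]
  | hadd a b ha hb => rw [map_add, map_add, ha, hb]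
  | hmul a b ha hb => rw [map_mul, map_mul, ha, hb]

@[simp]
theorem lift_of {X A : Type*} [Ring A] [StarRing A] [Algebra ℂ A] [StarModule ℂ A] (w : X → A)
    (x : X) : lift w (of x) = w x := by
  change MonoidAlgebra.lift ℂ A (FreeMonoid (X × Bool))
      (FreeMonoid.lift fun y => if y.2 then star (w y.1) else w y.1) (MonoidAlgebra.single _ 1) = _
  rw [MonoidAlgebra.lift_single]
  simp

end FreeStarAlgebra

/-! ### The universal C*-algebra of a presentation

A presentation consists of a type `X` of generators and a family `r` of relations `a = b` between
noncommutative star-polynomials in the generators. -/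

/-- A C*-seminorm on a complex star-algebra. -/
structure IsCStarSeminorm {A : Type*} [Ring A] [StarRing A] [Algebra ℂ A] (p : Seminorm ℂ A) :
    Prop where
  mul_le : ∀ a b, p (a * b) ≤ p a * p b
  star_mul_self : ∀ a, p (star a * a) = p a ^ 2

/-- A C*-seminorm on the free star-algebra for which the relations `r` hold. -/
structure IsAdmissible {X : Type*} (r : FreeStarAlgebra X → FreeStarAlgebra X → Prop)
    (p : Seminorm ℂ (FreeStarAlgebra X)) : Prop extends IsCStarSeminorm p where
  rel : ∀ a b, r a b → p (a - b) = 0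

/-- The relations bound the norm of every generator. This is the condition for the universal
C*-algebra to exist. -/
def IsBoundedPresentation {X : Type*} (r : FreeStarAlgebra X → FreeStarAlgebra X → Prop) : Prop :=
  ∀ x, ∃ C : ℝ, ∀ p, IsAdmissible r p → p (FreeStarAlgebra.of x) ≤ C

/-- The supremum of all C*-seminorms for which the relations hold. -/
def universalNorm {X : Type*} (r : FreeStarAlgebra X → FreeStarAlgebra X → Prop)
    (a : FreeStarAlgebra X) : ℝ :=
  ⨆ p : {p : Seminorm ℂ (FreeStarAlgebra X) // IsAdmissible r p}, p.1 a

namespace IsCStarSeminorm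

variable {A : Type*} [Ring A] [StarRing A] [Algebra ℂ A] {p : Seminorm ℂ A}

theorem le_star (hp : IsCStarSeminorm p) (a : A) : p a ≤ p (star a) := by
  have h1 := hp.mul_le (star a) a
  rw [hp.star_mul_self] at h1
  have h2 := apply_nonneg p a
  have h3 := apply_nonneg p (star a)
  by_contra! h
  nlinarith

theorem map_star (hp : IsCStarSeminorm p) (a : A) : p (star a) = p a :=
  le_antisymm (by simpa using hp.le_star (star a)) (hp.le_star a)

theorem map_one_le (hp : IsCStarSeminorm p) : p 1 ≤ 1 := by
  have h := hp.star_mul_self 1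
  rw [star_one, one_mul] at h
  nlinarith

theorem le_one_of_isometry (hp : IsCStarSeminorm p) {a : A} (h : p (star a * a - 1) = 0) :
    p a ≤ 1 := by
  have h1 : p (star a * a) ≤ 1 := by
    calc p (star a * a) = p ((star a * a - 1) + 1) := by rw [sub_add_cancel]
      _ ≤ p (star a * a - 1) + p 1 := map_add_le_add p _ _
      _ ≤ 1 := by rw [h, zero_add]; exact hp.map_one_le
  rw [hp.star_mul_self] at h1
  nlinarith [apply_nonneg p a]

end IsCStarSeminorm

section Universal

variable {X : Type*} {r : FreeStarAlgebra X → FreeStarAlgebra X → Prop}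

theorem isAdmissible_zero (r : FreeStarAlgebra X → FreeStarAlgebra X → Prop) :
    IsAdmissible r 0 where
  mul_le := by simp
  star_mul_self := by simp
  rel := by simp

instance (r : FreeStarAlgebra X → FreeStarAlgebra X → Prop) :
    Nonempty {p : Seminorm ℂ (FreeStarAlgebra X) // IsAdmissible r p} :=
  ⟨⟨0, isAdmissible_zero r⟩⟩

theorem IsBoundedPresentation.bddAbove (hr : IsBoundedPresentation r) (a : FreeStarAlgebra X) :
    BddAbove (Set.range fun p : {p : Seminorm ℂ (FreeStarAlgebra X) // IsAdmissible r p} =>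
      p.1 a) := by
  suffices h : ∃ C : ℝ, ∀ p, IsAdmissible r p → p a ≤ C by
    obtain ⟨C, hC⟩ := h
    exact ⟨C, by rintro _ ⟨p, rfl⟩; exact hC p.1 p.2⟩
  induction a using FreeStarAlgebra.induction with
  | hscalar c =>
    refine ⟨‖c‖, fun p hp => ?_⟩
    rw [Algebra.algebraMap_eq_smul_one, map_smul_eq_mul]
    exact mul_le_of_le_one_right (norm_nonneg c) hp.map_one_le
  | hletter y =>
    obtain ⟨x, b⟩ := y
    obtain ⟨C, hC⟩ := hr x
    refine ⟨C, fun p hp => ?_⟩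
    cases b with
    | false => exact hC p hp
    | true => rw [FreeStarAlgebra.single_true, hp.map_star]; exact hC p hp
  | hadd a b ha hb =>
    obtain ⟨C, hC⟩ := ha
    obtain ⟨D, hD⟩ := hb
    exact ⟨C + D, fun p hp => (map_add_le_add p _ _).trans (add_le_add (hC p hp) (hD p hp))⟩
  | hmul a b ha hb =>
    obtain ⟨C, hC⟩ := ha
    obtain ⟨D, hD⟩ := hb
    exact ⟨C * D, fun p hp => (hp.mul_le _ _).trans
      (mul_le_mul (hC p hp) (hD p hp) (apply_nonneg p b) ((apply_nonneg p a).trans (hC p hp)))⟩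

theorem IsAdmissible.le_universalNorm (hr : IsBoundedPresentation r)
    {p : Seminorm ℂ (FreeStarAlgebra X)} (hp : IsAdmissible r p) (a : FreeStarAlgebra X) :
    p a ≤ universalNorm r a :=
  le_ciSup (hr.bddAbove a) ⟨p, hp⟩

theorem universalNorm_le {a : FreeStarAlgebra X} {C : ℝ}
    (h : ∀ p : Seminorm ℂ (FreeStarAlgebra X), IsAdmissible r p → p a ≤ C) :
    universalNorm r a ≤ C :=
  ciSup_le fun p => h p.1 p.2

theorem universalNorm_nonneg (r : FreeStarAlgebra X → FreeStarAlgebra X → Prop)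
    (a : FreeStarAlgebra X) : 0 ≤ universalNorm r a :=
  Real.iSup_nonneg fun p => apply_nonneg p.1 a

/-- The free star-algebra, equipped with the universal C*-seminorm of a presentation. -/
def PreUniversal (r : FreeStarAlgebra X → FreeStarAlgebra X → Prop)
    (_hr : IsBoundedPresentation r) : Type _ :=
  FreeStarAlgebra X

variable (hr : IsBoundedPresentation r)

instance : Ring (PreUniversal r hr) := inferInstanceAs (Ring (FreeStarAlgebra X))
instance : StarRing (PreUniversal r hr) := inferInstanceAs (StarRing (FreeStarAlgebra X))
instance : Algebra ℂ (PreUniversal r hr) := inferInstanceAs (Algebra ℂ (FreeStarAlgebra X))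
instance : StarModule ℂ (PreUniversal r hr) :=
  inferInstanceAs (StarModule ℂ (FreeStarAlgebra X))

/-- The universal C*-seminorm as a ring seminorm. -/
def universalRingSeminorm : RingSeminorm (PreUniversal r hr) where
  toFun := universalNorm r
  map_zero' := le_antisymm (universalNorm_le fun p _ => (map_zero p).le) (universalNorm_nonneg r _)
  add_le' a b := universalNorm_le fun p hp => (map_add_le_add p a b).trans
    (add_le_add (hp.le_universalNorm hr a) (hp.le_universalNorm hr b))
  neg' a := by
    unfold universalNorm
    exact congrArg _ (funext fun p => map_neg_eq_map p.1 a)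
  mul_le' a b := universalNorm_le fun p hp => (hp.mul_le a b).trans
    (mul_le_mul (hp.le_universalNorm hr a) (hp.le_universalNorm hr b) (apply_nonneg p b)
      (universalNorm_nonneg r a))

instance : SeminormedRing (PreUniversal r hr) where
  __ := (universalRingSeminorm hr).toAddGroupSeminorm.toSeminormedAddCommGroup
  __ := (inferInstance : Ring (PreUniversal r hr))
  norm_mul_le := (universalRingSeminorm hr).mul_le'

theorem PreUniversal.norm_def (a : PreUniversal r hr) : ‖a‖ = universalNorm r a := rfl

instance : NormedAlgebra ℂ (PreUniversal r hr) where
  norm_smul_le c a := universalNorm_le fun p hp => by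
    have h : p (c • (a : FreeStarAlgebra X)) = ‖c‖ * p a := map_smul_eq_mul p c a
    exact h.le.trans (mul_le_mul_of_nonneg_left (hp.le_universalNorm hr a) (norm_nonneg c))

instance : NormedStarGroup (PreUniversal r hr) where
  norm_star_le a := universalNorm_le fun p hp =>
    (hp.map_star (a : FreeStarAlgebra X)).le.trans (hp.le_universalNorm hr a)

theorem PreUniversal.norm_mul_self_le (a : PreUniversal r hr) : ‖a‖ * ‖a‖ ≤ ‖star a * a‖ := by
  have h0 : 0 ≤ ‖a‖ := norm_nonneg a
  have h : ‖a‖ ≤ Real.sqrt ‖star a * a‖ := universalNorm_le fun p hp => by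
    refine Real.le_sqrt_of_sq_le ?_
    exact (hp.star_mul_self (a : FreeStarAlgebra X)).ge.trans (hp.le_universalNorm hr _)
  calc ‖a‖ * ‖a‖ ≤ Real.sqrt ‖star a * a‖ * Real.sqrt ‖star a * a‖ :=
        mul_le_mul h h h0 (Real.sqrt_nonneg _)
    _ = ‖star a * a‖ := Real.mul_self_sqrt (norm_nonneg _)

/-- The universal C*-algebra of a presentation: the Hausdorff completion of the free star-algebra
on the generators with respect to the largest C*-seminorm for which the relations hold. -/
def UniversalCStarAlgebra (r : FreeStarAlgebra X → FreeStarAlgebra X → Prop)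
    (hr : IsBoundedPresentation r) : Type _ :=
  UniformSpace.Completion (PreUniversal r hr)

namespace UniversalCStarAlgebra

open UniformSpace

instance : NormedRing (UniversalCStarAlgebra r hr) :=
  inferInstanceAs (NormedRing (Completion (PreUniversal r hr)))

instance : CompleteSpace (UniversalCStarAlgebra r hr) :=
  inferInstanceAs (CompleteSpace (Completion (PreUniversal r hr)))

instance : Algebra ℂ (UniversalCStarAlgebra r hr) :=
  inferInstanceAs (Algebra ℂ (Completion (PreUniversal r hr)))

instance : NormedAlgebra ℂ (UniversalCStarAlgebra r hr) where
  norm_smul_le c a :=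
    norm_smul_le (α := ℂ) (β := Completion (PreUniversal r hr)) c a

/-- The canonical map from the free star-algebra to the completion. -/
def mk : FreeStarAlgebra X →+* UniversalCStarAlgebra r hr :=
  (Completion.coeRingHom : PreUniversal r hr →+* Completion (PreUniversal r hr))

theorem norm_mk (a : FreeStarAlgebra X) : ‖mk hr a‖ = universalNorm r a :=
  Completion.norm_coe (E := PreUniversal r hr) a

theorem denseRange_mk : DenseRange (mk hr) :=
  Completion.denseRange_coe (α := PreUniversal r hr)

theorem uniformContinuous_star : UniformContinuous (star : PreUniversal r hr → PreUniversal r hr) :=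
  (starNormedAddGroupHom : NormedAddGroupHom (PreUniversal r hr) (PreUniversal r hr)).uniformContinuous

instance : Star (UniversalCStarAlgebra r hr) where
  star := Completion.map (star : PreUniversal r hr → PreUniversal r hr)

theorem continuous_star : Continuous (star : UniversalCStarAlgebra r hr → _) :=
  Completion.continuous_map

theorem star_mk (a : FreeStarAlgebra X) : star (mk hr a) = mk hr (star a) :=
  Completion.map_coe (uniformContinuous_star hr) a

instance : CStarAlgebra (UniversalCStarAlgebra r hr) where
  star_involutive a := by
    refine (denseRange_mk hr).induction_on (p := fun a => star (star a) = a) a ?_ ?_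
    · exact isClosed_eq ((continuous_star hr).comp (continuous_star hr)) continuous_id
    · intro a; rw [star_mk, star_mk, star_star]
  star_mul a b := by
    refine (denseRange_mk hr).induction_on₂ (p := fun a b => star (a * b) = star b * star a)
      ?_ ?_ a b
    · exact isClosed_eq ((continuous_star hr).comp continuous_mul)
        (((continuous_star hr).comp continuous_snd).mul ((continuous_star hr).comp continuous_fst))
    · intro a b; rw [← map_mul, star_mk, star_mk, star_mk, ← map_mul, star_mul]
  star_add a b := by
    refine (denseRange_mk hr).induction_on₂ (p := fun a b => star (a + b) = star a + star b)
      ?_ ?_ a b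
    · exact isClosed_eq ((continuous_star hr).comp continuous_add)
        (((continuous_star hr).comp continuous_fst).add ((continuous_star hr).comp continuous_snd))
    · intro a b; rw [← map_add, star_mk, star_mk, star_mk, ← map_add, star_add]
  norm_mul_self_le a := by
    refine (denseRange_mk hr).induction_on (p := fun a => ‖a‖ * ‖a‖ ≤ ‖star a * a‖) a ?_ ?_
    · exact isClosed_le (continuous_norm.mul continuous_norm)
        (continuous_norm.comp ((continuous_star hr).mul continuous_id))
    · intro a
      rw [star_mk, ← map_mul, norm_mk, norm_mk]
      exact PreUniversal.norm_mul_self_le hr a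
  star_smul c a := by
    refine (denseRange_mk hr).induction_on (p := fun a => star (c • a) = star c • star a) a ?_ ?_
    · exact isClosed_eq ((continuous_star hr).comp (continuous_const_smul c))
        ((continuous_star hr).const_smul (star c))
    · intro a
      have h (c : ℂ) (a : FreeStarAlgebra X) : c • mk hr a = mk hr (c • a) :=
        (Completion.coe_smul (X := PreUniversal r hr) c a).symm
      rw [h, star_mk, star_mk, h, star_smul]

/-- The canonical star-homomorphism from the free star-algebra. -/
def mkHom : FreeStarAlgebra X →⋆ₐ[ℂ] UniversalCStarAlgebra r hr where
  __ := mk hr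
  commutes' _ := rfl
  map_star' a := (star_mk hr a).symm

/-- The canonical generators. -/
def gen (x : X) : UniversalCStarAlgebra r hr := mk hr (FreeStarAlgebra.of x)

/-- The canonical generators satisfy the relations. -/
theorem lift_gen_eq {a b : FreeStarAlgebra X} (h : r a b) :
    FreeStarAlgebra.lift (gen hr) a = FreeStarAlgebra.lift (gen hr) b := by
  have key : FreeStarAlgebra.lift (gen hr) = mkHom hr := by
    refine FreeStarAlgebra.hom_ext fun x => ?_
    rw [FreeStarAlgebra.lift_of]; rfl
  rw [key, ← sub_eq_zero, ← map_sub, ← norm_eq_zero]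
  refine le_antisymm ?_ (norm_nonneg _)
  exact (norm_mk hr (a - b)).le.trans (universalNorm_le fun p hp => (hp.rel a b h).le)

/-- Star-homomorphisms out of the universal C*-algebra are determined by the generators. -/
theorem hom_ext {B : Type*} [CStarAlgebra B] {f g : UniversalCStarAlgebra r hr →⋆ₐ[ℂ] B}
    (h : ∀ x, f (gen hr x) = g (gen hr x)) : f = g := by
  have key : f.comp (mkHom hr) = g.comp (mkHom hr) := FreeStarAlgebra.hom_ext h
  have hf : Continuous f :=
    AddMonoidHomClass.continuous_of_bound f 1 fun a => by
      rw [one_mul]; exact NonUnitalStarAlgHom.norm_apply_le f a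
  have hg : Continuous g :=
    AddMonoidHomClass.continuous_of_bound g 1 fun a => by
      rw [one_mul]; exact NonUnitalStarAlgHom.norm_apply_le g a
  refine DFunLike.coe_injective ((denseRange_mk hr).equalizer hf hg (funext fun a => ?_))
  exact DFunLike.congr_fun key a

/-- The universal property: every family of elements of a unital C*-algebra that satisfies the
relations is the image of the canonical generators under a unital star-homomorphism. -/
theorem exists_lift {B : Type*} [CStarAlgebra B] (w : X → B)
    (hw : ∀ a b, r a b → FreeStarAlgebra.lift w a = FreeStarAlgebra.lift w b) :
    ∃ f : UniversalCStarAlgebra r hr →⋆ₐ[ℂ] B, ∀ x, f (gen hr x) = w x := by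
  let φ := FreeStarAlgebra.lift w
  let p : Seminorm ℂ (FreeStarAlgebra X) := (normSeminorm ℂ B).comp φ.toAlgHom.toLinearMap
  have hpa (a : FreeStarAlgebra X) : p a = ‖φ a‖ := rfl
  have hp : IsAdmissible r p :=
    { mul_le := fun a b => by
        rw [hpa, hpa, hpa, map_mul]; exact norm_mul_le _ _
      star_mul_self := fun a => by
        rw [hpa, hpa, map_mul, StarHomClass.map_star, CStarRing.norm_star_mul_self, sq]
      rel := fun a b h => by rw [hpa, map_sub, hw a b h, sub_self, norm_zero] }
  have hle (a : PreUniversal r hr) : ‖φ a‖ ≤ 1 * ‖a‖ := by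
    rw [one_mul]; exact hp.le_universalNorm hr a
  let ψ : PreUniversal r hr →+* B := (φ : FreeStarAlgebra X →+* B)
  have hψ : Continuous ψ :=
    AddMonoidHomClass.continuous_of_bound (ψ : PreUniversal r hr →+* B) 1 hle
  let F : UniversalCStarAlgebra r hr →+* B := Completion.extensionHom ψ hψ
  have hF (a : FreeStarAlgebra X) : F (mk hr a) = φ a := Completion.extensionHom_coe ψ hψ a
  have hFc : Continuous F := Completion.continuous_extension
  refine ⟨{ F with
    commutes' := fun c => ?_
    map_star' := fun a => ?_ }, fun x => ?_⟩
  · exact (hF (algebraMap ℂ _ c)).trans (AlgHomClass.commutes φ c)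
  · refine (denseRange_mk hr).induction_on (p := fun a => F (star a) = star (F a)) a ?_ ?_
    · exact isClosed_eq (hFc.comp (continuous_star hr)) hFc.star
    · intro a; rw [star_mk, hF, hF, StarHomClass.map_star]
  · exact (hF _).trans (FreeStarAlgebra.lift_of w x)

end UniversalCStarAlgebra

end Universal

/-! ### Words, constructible right ideals and independence -/

section Words

variable {G : Type*} [Group G] {P : Submonoid G}

/-- Words of even length in `P`: the list `[(p₁, p₂), (p₃, p₄), …]` stands for the word
`(p₁, p₂, p₃, p₄, …)`. -/
abbrev Word (P : Submonoid G) : Type _ := List (P × P)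

/-- The iterated left quotient `p₁⁻¹ p₂ p₃⁻¹ p₄ ⋯` of a word. -/
def Word.dot (α : Word P) : G := (α.map fun x => (x.1 : G)⁻¹ * (x.2 : G)).prod

/-- A word is neutral if its iterated left quotient is the identity. -/
def Word.IsNeutral (α : Word P) : Prop := Word.dot α = 1

/-- The iterated quotient set
`{e, p₂ₖ⁻¹ p₂ₖ₋₁, p₂ₖ⁻¹ p₂ₖ₋₁ p₂ₖ₋₂⁻¹ p₂ₖ₋₃, …}` of the word `(p₁, …, p₂ₖ)`. Its elements are
the inverses of the iterated left quotients of the final segments of the word. -/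
def Word.quotientSet (α : Word P) : Set G := {g | ∃ s : Word P, s <:+ α ∧ g = (Word.dot s)⁻¹}

/-- The constructible right ideal `K(α) = ⋂_{g ∈ Q(α)} gP`, as a subset of `P`. -/
def Word.ideal (α : Word P) : Set P := {s | ∀ g ∈ Word.quotientSet α, ∃ t : P, g * (t : G) = s}

/-- The product `w_{p₁}* w_{p₂} w_{p₃}* w_{p₄} ⋯` for a map `w` and a word `(p₁, p₂, p₃, …)`. -/
def Word.eval {A : Type*} [Monoid A] [Star A] (w : P → A) (α : Word P) : A :=
  (α.map fun x => star (w x.1) * w x.2).prod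

/-- The set of constructible right ideals of `P`. -/
def constructibleIdeals (P : Submonoid G) : Set (Set P) := Set.range (Word.ideal (P := P))

/-- Independence: whenever the union of a nonempty finite family of constructible right ideals is
a constructible right ideal, that union is a member of the family. -/
def SatisfiesIndependence (P : Submonoid G) : Prop :=
  ∀ F : Set (Set P), F.Finite → F.Nonempty → F ⊆ constructibleIdeals P →
    ⋃₀ F ∈ constructibleIdeals P → ⋃₀ F ∈ F

/-! ### The algebra presented by (T1)-(T3) and the universal Toeplitz algebra -/

/-- The relations (T1), (T2), (T3) in the generators `w_p`, `p ∈ P`. -/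
inductive SharpRel (P : Submonoid G) : FreeStarAlgebra P → FreeStarAlgebra P → Prop
  | t1 : SharpRel P (FreeStarAlgebra.of 1) 1
  | t2 (α : Word P) : α.IsNeutral → α.ideal = ∅ → SharpRel P (α.eval FreeStarAlgebra.of) 0
  | t3 (α β : Word P) : α.IsNeutral → β.IsNeutral → α.ideal = β.ideal →
      SharpRel P (α.eval FreeStarAlgebra.of) (β.eval FreeStarAlgebra.of)

/-- The relations (T1), (T2), (T3), (T4) in the generators `t_p`, `p ∈ P`. In (T4) the nonempty
finite set `F` is given by an enumeration, and the product is taken in the order of the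
enumeration. -/
inductive ToeplitzRel (P : Submonoid G) : FreeStarAlgebra P → FreeStarAlgebra P → Prop
  | sharp (a b : FreeStarAlgebra P) : SharpRel P a b → ToeplitzRel P a b
  | t4 (α : Word P) (F : List (Word P)) : α.IsNeutral → F ≠ [] → (∀ β ∈ F, β.IsNeutral) →
      α.ideal = ⋃ β ∈ F, β.ideal →
      ToeplitzRel P
        (F.map fun β => α.eval FreeStarAlgebra.of - β.eval FreeStarAlgebra.of).prod 0

theorem Word.isNeutral_nil : Word.IsNeutral ([] : Word P) := rfl

theorem Word.isNeutral_pair (p : P) : Word.IsNeutral ([(p, p)] : Word P) := by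
  simp [Word.IsNeutral, Word.dot]

theorem Word.ideal_pair (p : P) :
    Word.ideal ([(p, p)] : Word P) = Word.ideal ([] : Word P) := by
  have h : ∀ s : Word P, s <:+ [(p, p)] → Word.dot s = 1 := by
    intro s hs
    rcases List.suffix_cons_iff.1 hs with rfl | hs
    · exact Word.isNeutral_pair p
    · rw [List.suffix_nil.1 hs]; exact Word.isNeutral_nil
  have h' : ∀ s : Word P, s <:+ [] → Word.dot s = 1 := by
    intro s hs
    rw [List.suffix_nil.1 hs]; exact Word.isNeutral_nil
  ext x
  constructor
  · rintro - g ⟨s, hs, rfl⟩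
    exact ⟨x, by rw [h' s hs]; simp⟩
  · rintro - g ⟨s, hs, rfl⟩
    exact ⟨x, by rw [h s hs]; simp⟩

theorem SharpRel.isometry (p : P) :
    SharpRel P (star (FreeStarAlgebra.of p) * FreeStarAlgebra.of p) 1 := by
  have h := SharpRel.t3 _ _ (Word.isNeutral_pair p) Word.isNeutral_nil (Word.ideal_pair p)
  simpa [Word.eval] using h

theorem sharpRel_bounded (P : Submonoid G) : IsBoundedPresentation (SharpRel P) := fun x =>
  ⟨1, fun _ hp => hp.le_one_of_isometry (hp.rel _ _ (SharpRel.isometry x))⟩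

theorem toeplitzRel_bounded (P : Submonoid G) : IsBoundedPresentation (ToeplitzRel P) := fun x =>
  ⟨1, fun _ hp => hp.le_one_of_isometry (hp.rel _ _ (.sharp _ _ (SharpRel.isometry x)))⟩

/-- The universal C*-algebra `C*_#(P)` of the relations (T1)-(T3). -/
abbrev SharpAlgebra (P : Submonoid G) : Type _ :=
  UniversalCStarAlgebra (SharpRel P) (sharpRel_bounded P)

/-- The canonical generators `w_p` of `C*_#(P)`. -/
def SharpAlgebra.w (p : P) : SharpAlgebra P := UniversalCStarAlgebra.gen (sharpRel_bounded P) p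

/-- The universal Toeplitz algebra `T_u(P)`. -/
abbrev UniversalToeplitzAlgebra (P : Submonoid G) : Type _ :=
  UniversalCStarAlgebra (ToeplitzRel P) (toeplitzRel_bounded P)

/-- The canonical generators `t_p` of `T_u(P)`. -/
def UniversalToeplitzAlgebra.t (p : P) : UniversalToeplitzAlgebra P :=
  UniversalCStarAlgebra.gen (toeplitzRel_bounded P) p

/-! ### Li's semigroup C*-algebra -/

/-- The generators of Li's semigroup C*-algebra: `v_p` for `p ∈ P` and `e_S` for `S` a
constructible right ideal or the empty set. -/
inductive LiGenerator (P : Submonoid G)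
  | v (p : P) : LiGenerator P
  | e (S : Set P) (hS : S ∈ constructibleIdeals P ∪ {∅}) : LiGenerator P

/-- The relations of Li's semigroup C*-algebra: the `v_p` are isometries, the `e_S` are
projections, `v_p v_q = v_{pq}`, `e_∅ = 0`, and `e_S` is the product of the `v`'s along any neutral
word `α` with `K(α) = S`. -/
inductive LiRel (P : Submonoid G) :
    FreeStarAlgebra (LiGenerator P) → FreeStarAlgebra (LiGenerator P) → Prop
  | isometry (p : P) :
      LiRel P (star (FreeStarAlgebra.of (.v p)) * FreeStarAlgebra.of (.v p)) 1
  | selfAdjoint (S : Set P) (hS : S ∈ constructibleIdeals P ∪ {∅}) :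
      LiRel P (star (FreeStarAlgebra.of (.e S hS))) (FreeStarAlgebra.of (.e S hS))
  | idempotent (S : Set P) (hS : S ∈ constructibleIdeals P ∪ {∅}) :
      LiRel P (FreeStarAlgebra.of (.e S hS) * FreeStarAlgebra.of (.e S hS))
        (FreeStarAlgebra.of (.e S hS))
  | mul (p q : P) :
      LiRel P (FreeStarAlgebra.of (.v p) * FreeStarAlgebra.of (.v q))
        (FreeStarAlgebra.of (.v (p * q)))
  | empty : LiRel P (FreeStarAlgebra.of (.e ∅ (Or.inr rfl))) 0
  | word (S : Set P) (hS : S ∈ constructibleIdeals P) (α : Word P) : α.IsNeutral → α.ideal = S →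
      LiRel P (α.eval fun p => FreeStarAlgebra.of (.v p)) (FreeStarAlgebra.of (.e S (Or.inl hS)))

theorem liRel_bounded (P : Submonoid G) : IsBoundedPresentation (LiRel P) := by
  rintro (p | ⟨S, hS⟩)
  · exact ⟨1, fun _ hp => hp.le_one_of_isometry (hp.rel _ _ (LiRel.isometry p))⟩
  · refine ⟨1, fun q hq => ?_⟩
    set x : FreeStarAlgebra (LiGenerator P) := FreeStarAlgebra.of (.e S hS)
    have h1 : q (star x - x) = 0 := hq.rel _ _ (LiRel.selfAdjoint S hS)
    have h2 : q (x * x - x) = 0 := hq.rel _ _ (LiRel.idempotent S hS)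
    have h3 : q ((star x - x) * x) ≤ 0 := by
      simpa [h1] using hq.mul_le (star x - x) x
    have h4 : q (star x * x) ≤ q x := by
      calc q (star x * x) = q ((star x - x) * x + ((x * x - x) + x)) := by
            congr 1; noncomm_ring
        _ ≤ q ((star x - x) * x) + (q (x * x - x) + q x) :=
            (map_add_le_add q _ _).trans (by gcongr; exact map_add_le_add q _ _)
        _ ≤ q x := by rw [h2]; linarith
    rw [hq.star_mul_self] at h4
    nlinarith [apply_nonneg q x]

/-- Li's semigroup C*-algebra `C*_s(P)`. -/
abbrev LiAlgebra (P : Submonoid G) : Type _ := UniversalCStarAlgebra (LiRel P) (liRel_bounded P)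

/-- The canonical isometries `v_p` of `C*_s(P)`. -/
def LiAlgebra.v (p : P) : LiAlgebra P := UniversalCStarAlgebra.gen (liRel_bounded P) (.v p)

end Words

end

/-! Following a word and then the same word backwards gives a neutral word with the same ideal, so
every constructible ideal is `K(α)` for some neutral `α`. For neutral words, (T3) compares a word
with its reversal and with its double, so the values are projections depending only on the ideal.
(T1) and (T3) also give `star (w (p * q)) * (w p * w q) = 1`, and the C*-identity then forces the
two isometries to coincide (`IsSharpFamily.map_mul`). Hence a family with (T1)-(T3) satisfies all of
Li's relations once `e_S` is sent to the value of any neutral word for `S`. As Li's isometries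
satisfy (T1)-(T3) themselves, both algebras have the same universal property
(`LiAlgebra.exists_hom`, `LiAlgebra.hom_ext`).

This property also yields `Λ`. Its range contains the dense star-algebra generated by the `t_p`, and
ranges of star-homomorphisms of C*-algebras are closed. Under independence, a union as in (T4)
equals one of its members, so one factor of the product vanishes by (T3); thus (T4) holds in
`C*_s(P)` and `Λ` has a left inverse.

The converse needs a representation of (T1)-(T3) in which (T4) can fail. The regular representation
on `ℓ²(P)` is useless here, since a point of a union lies in some member. Instead `P` acts on `ℓ²`
of its nonempty subsets, where a neutral `α` becomes the projection onto the subsets of `K(α)`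
(`exists_isSharpFamily_subset`). A set inside a union need not lie inside a member: if no `K(β)`
equals the union `K(α)`, the basis vector of `K(α)` is fixed by every factor of the (T4) product. -/

/-! ### Words: concatenation, reversal and their ideals. -/

namespace Word

variable {G : Type*} [Group G] {P : Submonoid G}

@[simp]
theorem dot_nil : Word.dot ([] : Word P) = 1 := rfl

theorem dot_cons (x : P × P) (α : Word P) :
    Word.dot (x :: α) = (x.1 : G)⁻¹ * (x.2 : G) * Word.dot α := by
  simp [Word.dot]

theorem dot_append (α β : Word P) : Word.dot (α ++ β) = Word.dot α * Word.dot β := by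
  simp [Word.dot]

/-- All final segments of the word `α` move `g` into `P`. -/
def Stays (α : Word P) (g : G) : Prop := ∀ s : Word P, s <:+ α → Word.dot s * g ∈ P

@[simp]
theorem stays_nil (g : G) : Stays ([] : Word P) g ↔ g ∈ P := by
  simp [Stays]

theorem stays_cons (x : P × P) (α : Word P) (g : G) :
    Stays (x :: α) g ↔ Word.dot (x :: α) * g ∈ P ∧ Stays α g := by
  constructor
  · exact fun h => ⟨h _ (List.suffix_refl _), fun s hs => h s (hs.trans (List.suffix_cons _ _))⟩
  · rintro ⟨h₁, h₂⟩ s hs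
    rcases List.suffix_cons_iff.1 hs with rfl | hs
    · exact h₁
    · exact h₂ s hs

theorem Stays.mem {α : Word P} {g : G} (h : Stays α g) : g ∈ P := by
  simpa using h [] (List.nil_suffix)

/-- A final segment of `α ++ β` is either one of `β` or `s ++ β` with `s` a final segment of `α`.
The point `g` ranges over `G` because its translate by `β.dot` is not known in advance to lie in
`P`. -/
theorem stays_append (α β : Word P) (g : G) :
    Stays (α ++ β) g ↔ Stays α (Word.dot β * g) ∧ Stays β g := by
  induction α with
  | nil => simpa using fun h : Stays β g => h β (List.suffix_refl _)
  | cons x α ih =>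
    rw [List.cons_append, stays_cons, stays_cons, ih, ← List.cons_append, dot_append, mul_assoc,
      and_assoc]

theorem mem_ideal {α : Word P} {x : P} : x ∈ Word.ideal α ↔ Stays α (x : G) := by
  constructor
  · intro h s hs
    obtain ⟨t, ht⟩ := h _ ⟨s, hs, rfl⟩
    rw [← ht, mul_inv_cancel_left]
    exact t.2
  · rintro h g ⟨s, hs, rfl⟩
    exact ⟨⟨_, h s hs⟩, by simp⟩

/-- The word read backwards. -/
def rev (α : Word P) : Word P := (α.map Prod.swap).reverse

@[simp]
theorem rev_nil : rev ([] : Word P) = [] := rfl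

theorem rev_cons (x : P × P) (α : Word P) : rev (x :: α) = rev α ++ [x.swap] := by
  simp [rev]

theorem dot_rev (α : Word P) : Word.dot (rev α) = (Word.dot α)⁻¹ := by
  induction α with
  | nil => simp
  | cons x α ih => rw [rev_cons, dot_append, ih, dot_cons, dot_cons]; simp

/-- Starting at the endpoint `α.dot * g`, the reversed word visits the same points as `α` does from
`g`, in the opposite order. -/
theorem stays_rev (α : Word P) (g : G) : Stays (rev α) (Word.dot α * g) ↔ Stays α g := by
  induction α with
  | nil => simp
  | cons x α ih =>
    have h : Word.dot [x.swap] * (Word.dot (x :: α) * g) = Word.dot α * g := by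
      simp only [dot_cons, dot_nil, Prod.fst_swap, Prod.snd_swap]; group
    rw [rev_cons, stays_append, h, ih, stays_cons, stays_cons, h, stays_nil]
    exact ⟨fun H => ⟨H.2.2, H.1⟩, fun H => ⟨H.2, H.2 α (List.suffix_refl _), H.1⟩⟩

theorem IsNeutral.rev {α : Word P} (h : α.IsNeutral) : (rev α).IsNeutral := by
  rw [Word.IsNeutral, dot_rev, h, inv_one]

theorem IsNeutral.append {α β : Word P} (hα : α.IsNeutral) (hβ : β.IsNeutral) :
    Word.IsNeutral (α ++ β) := by
  rw [Word.IsNeutral, dot_append, hα, hβ, one_mul]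

theorem isNeutral_rev_append (α : Word P) : Word.IsNeutral (rev α ++ α) := by
  rw [Word.IsNeutral, dot_append, dot_rev, inv_mul_cancel]

theorem ideal_rev {α : Word P} (h : α.IsNeutral) : (rev α).ideal = α.ideal := by
  ext x
  have := stays_rev α (x : G)
  rwa [h, one_mul, ← mem_ideal, ← mem_ideal] at this

theorem ideal_append (α : Word P) {β : Word P} (h : β.IsNeutral) :
    Word.ideal (α ++ β) = α.ideal ∩ β.ideal := by
  ext x
  rw [Set.mem_inter_iff, mem_ideal, mem_ideal, mem_ideal, stays_append, h, one_mul]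

theorem ideal_rev_append (α : Word P) : Word.ideal (rev α ++ α) = α.ideal := by
  ext x
  rw [mem_ideal, mem_ideal, stays_append, stays_rev, and_self]

/-- This lets relations that concern only neutral words reach every constructible ideal. -/
theorem exists_neutral {S : Set P} (hS : S ∈ constructibleIdeals P) :
    ∃ α : Word P, α.IsNeutral ∧ α.ideal = S := by
  obtain ⟨α, rfl⟩ := hS
  exact ⟨_, isNeutral_rev_append α, ideal_rev_append α⟩

section Eval

variable {A : Type*}

@[simp]
theorem eval_nil [Monoid A] [Star A] (w : P → A) : Word.eval w ([] : Word P) = 1 := rfl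

theorem eval_cons [Monoid A] [Star A] (w : P → A) (x : P × P) (α : Word P) :
    Word.eval w (x :: α) = star (w x.1) * w x.2 * Word.eval w α := by
  simp [Word.eval]

theorem eval_append [Monoid A] [Star A] (w : P → A) (α β : Word P) :
    Word.eval w (α ++ β) = Word.eval w α * Word.eval w β := by
  simp [Word.eval]

theorem eval_rev [Monoid A] [StarMul A] (w : P → A) (α : Word P) :
    Word.eval w (rev α) = star (Word.eval w α) := by
  induction α with
  | nil => simp
  | cons x α ih => rw [rev_cons, eval_append, ih, eval_cons, eval_cons]; simp

theorem map_eval {B F : Type*} [Monoid A] [Star A] [Monoid B] [Star B] [FunLike F A B]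
    [MonoidHomClass F A B] [StarHomClass F A B] (f : F) (w : P → A) (α : Word P) :
    f (Word.eval w α) = Word.eval (fun p => f (w p)) α := by
  induction α with
  | nil => simp
  | cons x α ih => rw [eval_cons, eval_cons, map_mul, map_mul, map_star, ih]

end Eval

end Word

/-! ### Families satisfying (T1)-(T3) and the universal property of Li's algebra. -/

section Presentation

variable {G : Type*} [Group G] {P : Submonoid G}

/-- The relations (T1)-(T3) for a map from `P` to a star-monoid with zero. -/
structure IsSharpFamily {A : Type*} [MonoidWithZero A] [Star A] (w : P → A) : Prop where
  map_one : w 1 = 1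
  eval_eq_zero : ∀ α : Word P, α.IsNeutral → α.ideal = ∅ → α.eval w = 0
  eval_congr : ∀ α β : Word P, α.IsNeutral → β.IsNeutral → α.ideal = β.ideal →
    α.eval w = β.eval w

theorem Word.lift_eval {X A : Type*} [Ring A] [StarRing A] [Algebra ℂ A] [StarModule ℂ A]
    (w : X → A) (g : P → X) (α : Word P) :
    FreeStarAlgebra.lift w (α.eval fun p => FreeStarAlgebra.of (g p)) =
      α.eval fun p => w (g p) := by
  rw [Word.map_eval]; simp

theorem Word.lift_eval_of {A : Type*} [Ring A] [StarRing A] [Algebra ℂ A] [StarModule ℂ A]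
    (w : P → A) (α : Word P) :
    FreeStarAlgebra.lift w (α.eval FreeStarAlgebra.of) = α.eval w :=
  Word.lift_eval w id α

theorem isSharpFamily_iff {A : Type*} [Ring A] [StarRing A] [Algebra ℂ A] [StarModule ℂ A]
    (w : P → A) : IsSharpFamily w ↔
      ∀ a b, SharpRel P a b → FreeStarAlgebra.lift w a = FreeStarAlgebra.lift w b := by
  constructor
  · rintro h a b (_ | ⟨α, h₁, h₂⟩ | ⟨α, β, h₁, h₂, h₃⟩)
    · simpa using h.map_one
    · rw [Word.lift_eval_of, h.eval_eq_zero α h₁ h₂, map_zero]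
    · rw [Word.lift_eval_of, Word.lift_eval_of, h.eval_congr α β h₁ h₂ h₃]
  · intro h
    refine ⟨?_, fun α h₁ h₂ => ?_, fun α β h₁ h₂ h₃ => ?_⟩
    · simpa using h _ _ .t1
    · simpa [Word.lift_eval_of] using h _ _ (.t2 α h₁ h₂)
    · simpa [Word.lift_eval_of] using h _ _ (.t3 α β h₁ h₂ h₃)

namespace IsSharpFamily

section

variable {A : Type*} [Ring A] [StarRing A] {w : P → A}

theorem star_mul_self (hw : IsSharpFamily w) (p : P) : star (w p) * w p = 1 := by
  simpa [Word.eval] using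
    hw.eval_congr _ _ (Word.isNeutral_pair p) Word.isNeutral_nil (Word.ideal_pair p)

theorem star_eval (hw : IsSharpFamily w) {α : Word P} (hα : α.IsNeutral) :
    star (α.eval w) = α.eval w := by
  rw [← Word.eval_rev]
  exact hw.eval_congr _ _ hα.rev hα (Word.ideal_rev hα)

theorem eval_mul_self (hw : IsSharpFamily w) {α : Word P} (hα : α.IsNeutral) :
    α.eval w * α.eval w = α.eval w := by
  rw [← Word.eval_append]
  exact hw.eval_congr _ _ (hα.append hα) hα (by rw [Word.ideal_append α hα, Set.inter_self])

end

/-- The word `(pq, p, 1, q)` is neutral with ideal `P`, so (T3) and (T1) give `y* x = 1` for the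
isometries `x = w p * w q` and `y = w (p * q)`. Then `(x - y)* (x - y) = 1 - 1 - 1 + 1 = 0`, and the
C*-identity gives `x = y`. -/
theorem map_mul {A : Type*} [CStarAlgebra A] {w : P → A} (hw : IsSharpFamily w) (p q : P) :
    w p * w q = w (p * q) := by
  have hn : Word.IsNeutral [(p * q, p), (1, q)] := by
    simp [Word.IsNeutral, Word.dot_cons]
  have hK : Word.ideal [(p * q, p), (1, q)] = Word.ideal [] := by
    ext x
    rw [Word.mem_ideal, Word.mem_ideal, Word.stays_cons, Word.stays_cons, hn]
    simpa [Word.dot_cons] using mul_mem q.2 x.2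
  have h₁ : star (w (p * q)) * (w p * w q) = 1 := by
    simpa [Word.eval_cons, hw.map_one, mul_assoc] using
      hw.eval_congr _ _ hn Word.isNeutral_nil hK
  have h₂ : star (w p * w q) * w (p * q) = 1 := by
    simpa using congrArg star h₁
  have h₃ : star (w p * w q) * (w p * w q) = 1 := by
    rw [star_mul, mul_assoc, ← mul_assoc (star (w p)), hw.star_mul_self, one_mul,
      hw.star_mul_self]
  rw [← sub_eq_zero, ← CStarRing.star_mul_self_eq_zero_iff, star_sub, sub_mul, mul_sub, mul_sub,
    h₁, h₂, h₃, hw.star_mul_self, sub_self]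

end IsSharpFamily

theorem SharpAlgebra.isSharpFamily (P : Submonoid G) :
    IsSharpFamily (SharpAlgebra.w (P := P)) :=
  (isSharpFamily_iff _).2 fun _ _ h => UniversalCStarAlgebra.lift_gen_eq (sharpRel_bounded P) h

theorem UniversalToeplitzAlgebra.isSharpFamily (P : Submonoid G) :
    IsSharpFamily (UniversalToeplitzAlgebra.t (P := P)) :=
  (isSharpFamily_iff _).2 fun _ _ h =>
    UniversalCStarAlgebra.lift_gen_eq (toeplitzRel_bounded P) (.sharp _ _ h)

theorem SharpAlgebra.exists_hom {B : Type*} [CStarAlgebra B] {w : P → B}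
    (hw : IsSharpFamily w) : ∃ f : SharpAlgebra P →⋆ₐ[ℂ] B, ∀ p, f (SharpAlgebra.w p) = w p :=
  UniversalCStarAlgebra.exists_lift (sharpRel_bounded P) w ((isSharpFamily_iff w).1 hw)

namespace LiAlgebra

/-- The canonical projections of Li's semigroup C*-algebra. -/
noncomputable def e (S : Set P) (hS : S ∈ constructibleIdeals P ∪ {∅}) : LiAlgebra P :=
  UniversalCStarAlgebra.gen (liRel_bounded P) (.e S hS)

theorem e_empty (h : ∅ ∈ constructibleIdeals P ∪ {∅}) : e (P := P) ∅ h = 0 := by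
  have := UniversalCStarAlgebra.lift_gen_eq (liRel_bounded P) LiRel.empty
  rwa [FreeStarAlgebra.lift_of, map_zero] at this

theorem eval_v {α : Word P} (hα : α.IsNeutral) :
    α.eval v = e α.ideal (Or.inl ⟨α, rfl⟩) := by
  have := UniversalCStarAlgebra.lift_gen_eq (liRel_bounded P) (LiRel.word _ ⟨α, rfl⟩ α hα rfl)
  rwa [Word.lift_eval, FreeStarAlgebra.lift_of] at this

theorem isSharpFamily (P : Submonoid G) : IsSharpFamily (v (P := P)) where
  map_one := by
    have h₁ : star (v (1 : P)) * v (1 : P) = 1 := by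
      have := UniversalCStarAlgebra.lift_gen_eq (liRel_bounded P) (LiRel.isometry 1)
      rwa [map_mul, map_star, FreeStarAlgebra.lift_of, map_one] at this
    have h₂ : v (1 : P) * v (1 : P) = v (1 : P) := by
      have := UniversalCStarAlgebra.lift_gen_eq (liRel_bounded P) (LiRel.mul 1 1)
      rwa [map_mul, FreeStarAlgebra.lift_of, FreeStarAlgebra.lift_of, mul_one] at this
    -- (T1) is not among Li's relations; it holds because an idempotent isometry is the identity.
    calc v (1 : P) = star (v (1 : P)) * v (1 : P) * v (1 : P) := by rw [h₁, one_mul]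
      _ = 1 := by rw [mul_assoc, h₂, h₁]
  eval_eq_zero α h₁ h₂ := by
    rw [eval_v h₁]
    simp only [h₂]
    exact e_empty _
  eval_congr α β h₁ h₂ h₃ := by
    rw [eval_v h₁, eval_v h₂]
    simp only [h₃]

/-- Star-homomorphisms out of Li's semigroup C*-algebra are determined by the isometries. -/
theorem hom_ext {B : Type*} [CStarAlgebra B] {f g : LiAlgebra P →⋆ₐ[ℂ] B}
    (h : ∀ p, f (v p) = g (v p)) : f = g := by
  refine UniversalCStarAlgebra.hom_ext (liRel_bounded P) ?_
  rintro (p | ⟨S, hS⟩)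
  · exact h p
  · change f (e S hS) = g (e S hS)
    -- A projection of a constructible ideal is a product of the `v`'s and their adjoints; the only
    -- other possible index is `∅`, whose projection is zero.
    by_cases hS' : S ∈ constructibleIdeals P
    · obtain ⟨α, hα, rfl⟩ := Word.exists_neutral hS'
      rw [← eval_v hα, Word.map_eval, Word.map_eval, funext h]
    · obtain rfl : S = ∅ := hS.resolve_left hS'
      rw [e_empty, map_zero, map_zero]

theorem exists_hom {B : Type*} [CStarAlgebra B] {w : P → B} (hw : IsSharpFamily w) :
    ∃ f : LiAlgebra P →⋆ₐ[ℂ] B, ∀ p, f (v p) = w p := by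
  classical
  -- The image of `e_S`; (T3) makes it independent of the chosen neutral word. Among the indices of
  -- Li's projections, the default `0` can only be met at `S = ∅`.
  let c (S : Set P) : B :=
    if h : S ∈ constructibleIdeals P then (Word.exists_neutral h).choose.eval w else 0
  have hc (α : Word P) (hα : α.IsNeutral) : c α.ideal = α.eval w := by
    have h : α.ideal ∈ constructibleIdeals P := ⟨α, rfl⟩
    have h' := (Word.exists_neutral h).choose_spec
    simp only [c, dif_pos h]
    exact hw.eval_congr _ _ h'.1 hα h'.2
  have hc₀ (S : Set P) : c S = 0 ∨ ∃ α : Word P, α.IsNeutral ∧ c S = α.eval w := by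
    by_cases h : S ∈ constructibleIdeals P
    · obtain ⟨α, hα, rfl⟩ := Word.exists_neutral h
      exact Or.inr ⟨α, hα, hc α hα⟩
    · exact Or.inl (dif_neg h)
  let W : LiGenerator P → B
    | .v p => w p
    | .e S _ => c S
  obtain ⟨f, hf⟩ := UniversalCStarAlgebra.exists_lift (liRel_bounded P) W (by
    rintro _ _ (p | ⟨S, hS⟩ | ⟨S, hS⟩ | ⟨p, q⟩ | _ | ⟨S, hS, α, hα, rfl⟩)
    · rw [map_mul, map_star, FreeStarAlgebra.lift_of, map_one]
      exact hw.star_mul_self p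
    · rw [map_star, FreeStarAlgebra.lift_of]
      change star (c S) = c S
      rcases hc₀ S with h | ⟨α, hα, h⟩
      · rw [h, star_zero]
      · rw [h, hw.star_eval hα]
    · rcases hc₀ S with h | ⟨α, hα, h⟩
      · simp [W, h]
      · simpa [W, h] using hw.eval_mul_self hα
    · simpa [W] using hw.map_mul p q
    · rw [FreeStarAlgebra.lift_of, map_zero]
      change c ∅ = 0
      -- If `∅` is constructible its value comes from a word, and (T2) is what makes it zero.
      by_cases h : ∅ ∈ constructibleIdeals P
      · obtain ⟨α, hα, h'⟩ := Word.exists_neutral h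
        rw [← h', hc α hα, hw.eval_eq_zero α hα h']
      · exact dif_neg h
    · rw [Word.lift_eval, FreeStarAlgebra.lift_of]
      exact (hc α hα).symm)
  exact ⟨f, fun p => hf (.v p)⟩

end LiAlgebra

end Presentation

/-! ### Star-homomorphisms have closed range. -/

/-- A selfadjoint element in the image of a star-homomorphism lifts without increasing its norm. -/
theorem StarAlgHom.exists_norm_le_of_isSelfAdjoint {A B : Type*} [CStarAlgebra A] [CStarAlgebra B]
    (φ : A →⋆ₐ[ℂ] B) {a : A} (ha : IsSelfAdjoint a) : ∃ a' : A, φ a' = φ a ∧ ‖a'‖ ≤ ‖φ a‖ := by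
  -- Truncation at `±‖φ a‖` bounds `f(a)` by `‖φ a‖`, yet is the identity on the spectrum of `φ a`,
  -- so `φ (f(a)) = f(φ a) = φ a`.
  let f : ℝ → ℝ := fun x => max (-‖φ a‖) (min x ‖φ a‖)
  have hf : Continuous f := by fun_prop
  have hφ : Continuous φ :=
    AddMonoidHomClass.continuous_of_bound φ 1 fun a => by
      rw [one_mul]; exact NonUnitalStarAlgHom.norm_apply_le φ a
  have hb : IsSelfAdjoint (φ a) := ha.map φ
  refine ⟨cfc f a, ?_, ?_⟩
  · rw [StarAlgHomClass.map_cfc (R := ℝ) (S := ℂ) φ f a hf.continuousOn hφ ha hb]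
    conv_rhs => rw [← cfc_id ℝ (φ a) hb]
    refine cfc_congr fun x hx => ?_
    have h : ‖x‖ ≤ ‖φ a‖ := by
      have : Nontrivial B := by
        by_contra h
        rw [not_nontrivial_iff_subsingleton] at h
        simp at hx
      exact spectrum.norm_le_norm_of_mem hx
    rw [Real.norm_eq_abs, abs_le] at h
    simp [f, h.1, h.2]
  · refine norm_cfc_le (norm_nonneg _) fun x _ => ?_
    rw [Real.norm_eq_abs, abs_le]
    have := norm_nonneg (φ a)
    exact ⟨le_max_left _ _, max_le (by linarith) (min_le_right _ _)⟩

/-- Real and imaginary parts are lifted separately, whence the constant 2. Any uniform constant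
would serve the closed-range argument. -/
theorem StarAlgHom.exists_norm_le_two_mul {A B : Type*} [CStarAlgebra A] [CStarAlgebra B]
    (φ : A →⋆ₐ[ℂ] B) (a : A) : ∃ a' : A, φ a' = φ a ∧ ‖a'‖ ≤ 2 * ‖φ a‖ := by
  obtain ⟨x, hx, hx'⟩ := φ.exists_norm_le_of_isSelfAdjoint (realPart a).2
  obtain ⟨y, hy, hy'⟩ := φ.exists_norm_le_of_isSelfAdjoint (imaginaryPart a).2
  have hs (x : A) : φ ((2⁻¹ : ℝ) • x) = (2⁻¹ : ℝ) • φ x := map_smul (φ.restrictScalars ℝ) _ _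
  have h₁ : ‖φ (realPart a : A)‖ ≤ ‖φ a‖ := by
    have : φ (realPart a : A) = (realPart (φ a) : B) := by
      rw [realPart_apply_coe, realPart_apply_coe, hs, map_add, map_star]
    rw [this]
    exact realPart.norm_le (φ a)
  have h₂ : ‖φ (imaginaryPart a : A)‖ ≤ ‖φ a‖ := by
    have : φ (imaginaryPart a : A) = (imaginaryPart (φ a) : B) := by
      rw [imaginaryPart_apply_coe, imaginaryPart_apply_coe, map_smul, hs, map_sub, map_star]
    rw [this]
    exact imaginaryPart.norm_le (φ a)
  refine ⟨x + Complex.I • y, ?_, ?_⟩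
  · rw [map_add, map_smul, hx, hy, ← map_smul, ← map_add, realPart_add_I_smul_imaginaryPart]
  · calc ‖x + Complex.I • y‖ ≤ ‖x‖ + ‖Complex.I • y‖ := norm_add_le _ _
      _ = ‖x‖ + ‖y‖ := by rw [norm_smul, Complex.norm_I, one_mul]
      _ ≤ 2 * ‖φ a‖ := by linarith

/-- A star-homomorphism of C*-algebras with dense range is surjective. -/
theorem StarAlgHom.surjective_of_denseRange {A B : Type*} [CStarAlgebra A] [CStarAlgebra B]
    (φ : A →⋆ₐ[ℂ] B) (h : DenseRange φ) : Function.Surjective φ := by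
  let f : NormedAddGroupHom A B := AddMonoidHom.mkNormedAddGroupHom (φ : A →+ B) 1 fun a => by
    rw [one_mul]; exact NonUnitalStarAlgHom.norm_apply_le φ a
  -- Lifts with a uniform bound can be summed along a rapidly converging series, so by completeness
  -- of `A` liftability passes to the closure of the range.
  have hf : f.SurjectiveOnWith f.range 2 := by
    rintro _ ⟨a, rfl⟩
    exact φ.exists_norm_le_two_mul a
  intro b
  have hb : b ∈ f.range.topologicalClosure := h b
  obtain ⟨a, ha, -⟩ := controlled_closure_of_complete two_pos one_pos hf b hb
  exact ⟨a, ha⟩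

/-! ### The representation on `ℓ²` of the nonempty subsets of `P`. -/

open scoped lp

/-- An injective self-map of a set induces an isometry of its `ℓ²` space. -/
theorem lp.exists_isometry_of_injective {X : Type*} [DecidableEq X] {i : X → X}
    (hi : Function.Injective i) :
    ∃ V : ℓ²(X, ℂ) →L[ℂ] ℓ²(X, ℂ),
      (∀ x, V (lp.single 2 x 1) = lp.single 2 (i x) 1) ∧
      (∀ x, star V (lp.single 2 (i x) 1) = lp.single 2 x 1) ∧
      ∀ z, z ∉ Set.range i → star V (lp.single 2 z 1) = 0 := by
  have hv : Orthonormal ℂ fun x => (lp.single 2 (i x) 1 : ℓ²(X, ℂ)) := by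
    rw [orthonormal_iff_ite]
    intro x y
    rw [lp.inner_single_left, lp.single_apply]
    simp [Pi.single_apply, hi.eq_iff]
  let V := hv.orthogonalFamily.linearIsometry.toContinuousLinearMap
  have hV (x : X) : V (lp.single 2 x 1) = lp.single 2 (i x) 1 := by
    change hv.orthogonalFamily.linearIsometry _ = _
    simp
  -- The coordinate at `x` is the inner product of the image of the basis vector at `x` with the
  -- basis vector at `z`.
  have hV' (x z : X) : (star V (lp.single 2 z 1) : ℓ²(X, ℂ)) x = if z = i x then 1 else 0 := by
    have h := lp.inner_single_left (𝕜 := ℂ) x (1 : ℂ) (star V (lp.single 2 z 1) : ℓ²(X, ℂ))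
    rw [ContinuousLinearMap.star_eq_adjoint, ContinuousLinearMap.adjoint_inner_right, hV,
      lp.inner_single_left, lp.single_apply] at h
    rw [ContinuousLinearMap.star_eq_adjoint]
    simpa [Pi.single_apply, eq_comm] using h.symm
  refine ⟨V, hV, fun x => ?_, fun z hz => ?_⟩
  · ext y
    rw [hV', lp.single_apply]
    simp [Pi.single_apply, hi.eq_iff, eq_comm]
  · ext y
    rw [hV', if_neg fun h => hz ⟨y, h.symm⟩]
    rfl

theorem lp.clm_ext {X E : Type*} [DecidableEq X] [NormedAddCommGroup E] [NormedSpace ℂ E]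
    {S T : ℓ²(X, ℂ) →L[ℂ] E} (h : ∀ x, S (lp.single 2 x 1) = T (lp.single 2 x 1)) : S = T := by
  ext f
  have hf := lp.hasSum_single (by norm_num) f
  refine (hf.map S S.continuous).unique ?_
  convert hf.map T T.continuous using 1
  ext x
  have : lp.single 2 x (f x) = f x • (lp.single 2 x 1 : ℓ²(X, ℂ)) := by
    rw [← lp.single_smul, smul_eq_mul, mul_one]
  simp [this, h]

open scoped Pointwise

section Representation

variable {G : Type*} [Group G] (P : Submonoid G)

/-- The nonempty subsets of `P`, as subsets of `G`. -/
abbrev SubsetIndex : Type _ := {Y : Set G // Y.Nonempty ∧ Y ⊆ P}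

namespace SubsetIndex

variable {P}

/-- Left translation of the nonempty subsets of `P`. -/
def translate (p : P) (Y : SubsetIndex P) : SubsetIndex P :=
  ⟨(p : G) • Y.1, Y.2.1.smul_set, by
    rintro _ ⟨y, hy, rfl⟩
    exact mul_mem p.2 (Y.2.2 hy)⟩

theorem translate_injective (p : P) : Function.Injective (translate p) := fun Y Z h => by
  have : (p : G) • Y.1 = (p : G) • Z.1 := congrArg Subtype.val h
  exact Subtype.ext (smul_left_cancel _ this)

open Classical in
/-- The basis vector attached to a nonempty subset of `P`, and zero for all other sets. -/
noncomputable def vec (P : Submonoid G) (Y : Set G) : ℓ²(SubsetIndex P, ℂ) :=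
  if h : Y.Nonempty ∧ Y ⊆ P then lp.single 2 (⟨Y, h⟩ : SubsetIndex P) 1 else 0

open Classical in
theorem vec_coe (Y : SubsetIndex P) : vec P Y.1 = lp.single 2 Y 1 := dif_pos Y.2

theorem vec_ne_zero (Y : SubsetIndex P) : vec P Y.1 ≠ 0 := by
  classical
  rw [vec_coe, ← norm_ne_zero_iff, lp.norm_single (by norm_num)]
  simp

/-- The representation of `P` on the `ℓ²` space of its nonempty subsets by left translation. -/
theorem exists_representation (P : Submonoid G) :
    ∃ V : P → (ℓ²(SubsetIndex P, ℂ) →L[ℂ] ℓ²(SubsetIndex P, ℂ)),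
      (∀ (p : P) (Y : Set G), Y ⊆ P → V p (vec P Y) = vec P ((p : G) • Y)) ∧
      ∀ (p : P) (Y : Set G), Y ⊆ P → star (V p) (vec P Y) = vec P ((p : G)⁻¹ • Y) := by
  classical
  choose V hV₁ hV₂ hV₃ using fun p : P => lp.exists_isometry_of_injective (translate_injective p)
  have h₀ : vec P ∅ = 0 := dif_neg (by simp)
  refine ⟨V, fun p Y hY => ?_, fun p Y hY => ?_⟩
  · rcases Y.eq_empty_or_nonempty with rfl | hne
    · rw [Set.smul_set_empty, h₀, map_zero]
    · lift Y to SubsetIndex P using ⟨hne, hY⟩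
      rw [vec_coe, hV₁, ← vec_coe, translate]
  · rcases Y.eq_empty_or_nonempty with rfl | hne
    · rw [Set.smul_set_empty, h₀, map_zero]
    -- If the translate leaves `P`, then `Y` is outside the range of `translate p` and the adjoint
    -- kills its vector, in agreement with the default value of `vec`.
    · by_cases h : (p : G)⁻¹ • Y ⊆ P
      · have hY' : Y = (translate p ⟨(p : G)⁻¹ • Y, hne.smul_set, h⟩).1 := by
          simp [translate]
        conv_lhs => rw [hY', vec_coe, hV₂, ← vec_coe]
      · have hR : vec P ((p : G)⁻¹ • Y) = 0 := dif_neg fun h' => h h'.2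
        lift Y to SubsetIndex P using ⟨hne, hY⟩
        rw [hR, vec_coe, hV₃]
        rintro ⟨Z, rfl⟩
        exact h (by simpa [translate] using Z.2.2)

-- The word acts from its right end: each pair moves the current set, and the vector dies once a
-- translate leaves `P`. This can happen only at the inverse letter of a pair, since left
-- multiplication by an element of `P` preserves `P`.
open Classical in
theorem eval_vec {V : P → (ℓ²(SubsetIndex P, ℂ) →L[ℂ] ℓ²(SubsetIndex P, ℂ))}
    (hV : ∀ (p : P) (Y : Set G), Y ⊆ P → V p (vec P Y) = vec P ((p : G) • Y))
    (hV' : ∀ (p : P) (Y : Set G), Y ⊆ P → star (V p) (vec P Y) = vec P ((p : G)⁻¹ • Y))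
    (α : Word P) {Y : Set G} (hYP : Y ⊆ P) :
    α.eval V (vec P Y) = if ∀ y ∈ Y, α.Stays y then vec P (α.dot • Y) else 0 := by
  induction α with
  | nil =>
    rw [if_pos fun y hy => (Word.stays_nil y).2 (hYP hy)]
    simp
  | cons x α ih =>
    rw [Word.eval_cons, mul_apply_eq_comp, ih]
    by_cases hα : ∀ y ∈ Y, Word.Stays α y
    · have hαY : Word.dot α • Y ⊆ P := by
        rintro _ ⟨y, hy, rfl⟩
        exact hα y hy α (List.suffix_refl _)
      have hxY : (x.2 : G) • Word.dot α • Y ⊆ P := by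
        rintro _ ⟨y, hy, rfl⟩
        exact mul_mem x.2.2 (hαY hy)
      rw [if_pos hα, mul_apply_eq_comp, hV _ _ hαY, hV' _ _ hxY, smul_smul, smul_smul,
        ← Word.dot_cons]
      split_ifs with h
      · rfl
      · refine dif_neg fun h' => h fun y hy => (Word.stays_cons x α y).2 ⟨?_, hα y hy⟩
        exact h'.2 (Set.smul_mem_smul_set hy)
    · rw [if_neg hα, map_zero, if_neg]
      exact fun h => hα fun y hy => ((Word.stays_cons x α y).1 (h y hy)).2

end SubsetIndex

open Classical in
/-- There is a family satisfying (T1)-(T3) for which every neutral word `α` acts on the basis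
vectors given by the nonempty subsets of `P` as the projection onto those contained in `K(α)`. -/
theorem exists_isSharpFamily_subset :
    ∃ V : P → (ℓ²(SubsetIndex P, ℂ) →L[ℂ] ℓ²(SubsetIndex P, ℂ)), IsSharpFamily V ∧
      ∀ (α : Word P) (Y : SubsetIndex P), α.IsNeutral →
        α.eval V (SubsetIndex.vec P Y.1) =
          if Y.1 ⊆ (↑) '' α.ideal then SubsetIndex.vec P Y.1 else 0 := by
  obtain ⟨V, hV, hV'⟩ := SubsetIndex.exists_representation P
  have key (α : Word P) (Y : SubsetIndex P) (hα : α.IsNeutral) : α.eval V (SubsetIndex.vec P Y.1) =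
      if Y.1 ⊆ (↑) '' α.ideal then SubsetIndex.vec P Y.1 else 0 := by
    rw [SubsetIndex.eval_vec hV hV' α Y.2.2, hα, one_smul]
    refine if_congr (forall₂_congr fun y hy => ?_) rfl rfl
    refine ⟨fun h => ⟨⟨y, h.mem⟩, Word.mem_ideal.2 h, rfl⟩, ?_⟩
    rintro ⟨x, hx, rfl⟩
    exact Word.mem_ideal.1 hx
  refine ⟨V, ⟨?_, fun α h₁ h₂ => ?_, fun α β h₁ h₂ h₃ => ?_⟩, key⟩
  · refine lp.clm_ext fun Y => ?_
    rw [← SubsetIndex.vec_coe, hV _ _ Y.2.2]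
    simp
  · refine lp.clm_ext fun Y => ?_
    rw [← SubsetIndex.vec_coe, key α Y h₁, if_neg]
    · rfl
    · rw [h₂, Set.image_empty, Set.subset_empty_iff]
      exact Y.2.1.ne_empty
  · refine lp.clm_ext fun Y => ?_
    rw [← SubsetIndex.vec_coe, key α Y h₁, key β Y h₂, h₃]

end Representation

/-! ### Independence and the relation (T4). -/

section Independence

variable {G : Type*} [Group G] {P : Submonoid G}

/-- Independence provides `β ∈ F` with `K(β) = K(α)`, and (T3) annihilates the factor of that `β`.
-/
theorem IsSharpFamily.lift_eq_of_independence {A : Type*} [Ring A] [StarRing A] [Algebra ℂ A]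
    [StarModule ℂ A] {w : P → A} (hw : IsSharpFamily w) (hP : SatisfiesIndependence P)
    (a b : FreeStarAlgebra P) (h : ToeplitzRel P a b) :
    FreeStarAlgebra.lift w a = FreeStarAlgebra.lift w b := by
  rcases h with ⟨_, _, h⟩ | ⟨α, F, hα, hne, hF, hU⟩
  · exact (isSharpFamily_iff w).1 hw _ _ h
  · have hmem : ⋃₀ (Word.ideal '' {β | β ∈ F}) ∈ Word.ideal '' {β | β ∈ F} := by
      refine hP _ (F.finite_toSet.image _) ?_ ?_ ?_
      · obtain ⟨β, hβ⟩ := List.exists_mem_of_ne_nil F hne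
        exact ⟨_, β, hβ, rfl⟩
      · rintro _ ⟨β, -, rfl⟩
        exact ⟨β, rfl⟩
      · exact ⟨α, by rw [hU, Set.sUnion_image]; rfl⟩
    obtain ⟨β, hβ, h⟩ := hmem
    rw [map_zero, map_list_prod, List.map_map]
    refine List.prod_eq_zero (List.mem_map.2 ⟨β, hβ, ?_⟩)
    have hαβ : α.ideal = β.ideal := by
      rw [h, hU, Set.sUnion_image]; rfl
    rw [Function.comp_apply, map_sub, Word.lift_eval_of, Word.lift_eval_of,
      hw.eval_congr α β hα (hF β hβ) hαβ, sub_self]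

theorem UniversalToeplitzAlgebra.prod_eval_eq_zero {α : Word P} {F : List (Word P)}
    (hα : α.IsNeutral) (hne : F ≠ []) (hF : ∀ β ∈ F, β.IsNeutral)
    (hU : α.ideal = ⋃ β ∈ F, β.ideal) :
    (F.map fun β => α.eval (t (P := P)) - β.eval t).prod = 0 := by
  have h := UniversalCStarAlgebra.lift_gen_eq (toeplitzRel_bounded P) (.t4 α F hα hne hF hU)
  rw [map_zero, map_list_prod, List.map_map] at h
  rw [← h]
  congr 2
  funext β
  rw [Function.comp_apply, map_sub, Word.lift_eval_of, Word.lift_eval_of]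
  rfl

/-- If (T1)-(T3) imply (T4), then `P` satisfies independence. -/
theorem satisfiesIndependence_of_injective (Λ : LiAlgebra P →⋆ₐ[ℂ] UniversalToeplitzAlgebra P)
    (hΛ : ∀ p, Λ (LiAlgebra.v p) = UniversalToeplitzAlgebra.t p) (hinj : Function.Injective Λ) :
    SatisfiesIndependence P := by
  classical
  intro F hfin hne hF hU
  by_contra hnot
  obtain ⟨α, hα, hαU⟩ := Word.exists_neutral hU
  choose! W hWn hWi using fun S (hS : S ∈ F) => Word.exists_neutral (hF hS)
  let L : List (Word P) := hfin.toFinset.toList.map W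
  have hL (β : Word P) : β ∈ L ↔ ∃ S ∈ F, W S = β := by simp [L]
  have hLn : ∀ β ∈ L, β.IsNeutral := fun β hβ => by
    obtain ⟨S, hS, rfl⟩ := (hL β).1 hβ
    exact hWn S hS
  have hL₀ : L ≠ [] := by
    obtain ⟨S, hS⟩ := hne
    exact List.ne_nil_of_mem ((hL _).2 ⟨S, hS, rfl⟩)
  have hLU : α.ideal = ⋃ β ∈ L, β.ideal := by
    rw [hαU]
    ext x
    simp only [Set.mem_sUnion, Set.mem_iUnion, hL, exists_prop]
    constructor
    · rintro ⟨S, hS, hx⟩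
      exact ⟨_, ⟨S, hS, rfl⟩, by rwa [hWi S hS]⟩
    · rintro ⟨_, ⟨S, hS, rfl⟩, hx⟩
      exact ⟨S, hS, by rwa [hWi S hS] at hx⟩
  -- Injectivity of `Λ` pulls (T4) back to Li's algebra, hence to every family with (T1)-(T3).
  have hv : (L.map fun β => α.eval (LiAlgebra.v (P := P)) - β.eval LiAlgebra.v).prod = 0 := by
    apply hinj
    rw [map_zero, ← UniversalToeplitzAlgebra.prod_eval_eq_zero hα hL₀ hLn hLU, map_list_prod,
      List.map_map]
    congr 2
    funext β
    rw [Function.comp_apply, map_sub, Word.map_eval, Word.map_eval, funext hΛ]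
  -- An empty union would have only empty members and so would belong to `F`.
  have hS₀ : (α.ideal).Nonempty := by
    rw [Set.nonempty_iff_ne_empty, hαU]
    intro h
    obtain ⟨S, hS⟩ := hne
    refine hnot ?_
    rw [h, ← Set.subset_empty_iff.1 (h ▸ Set.subset_sUnion_of_mem hS)]
    exact hS
  let Y : SubsetIndex P := ⟨(↑) '' α.ideal, hS₀.image _, by rintro _ ⟨x, -, rfl⟩; exact x.2⟩
  obtain ⟨V, hV, hVα⟩ := exists_isSharpFamily_subset P
  obtain ⟨f, hf⟩ := LiAlgebra.exists_hom hV
  -- With `Y = K(α)`, the projection of `α` fixes the vector of `Y` and that of `β` kills it: `K(α)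
  -- ⊆ K(β)` would make the union equal to the member `K(β)`.
  have hfix : ∀ M : List (Word P), (∀ β ∈ M, β ∈ L) →
      (M.map fun β => α.eval V - β.eval V).prod (SubsetIndex.vec P Y.1) =
        SubsetIndex.vec P Y.1 := by
    intro M
    induction M with
    | nil => intro _; simp
    | cons β M ih =>
      intro hM
      obtain ⟨S, hS, rfl⟩ := (hL β).1 (hM β List.mem_cons_self)
      rw [List.map_cons, List.prod_cons, mul_apply_eq_comp,
        ih fun β hβ => hM β (List.mem_cons_of_mem _ hβ), sub_apply,
        hVα _ _ hα, hVα _ _ (hWn S hS), if_pos subset_rfl, if_neg, sub_zero]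
      rw [Set.image_subset_image_iff Subtype.coe_injective, hWi S hS, hαU]
      intro h
      exact hnot (h.antisymm (Set.subset_sUnion_of_mem hS) ▸ hS)
  refine SubsetIndex.vec_ne_zero Y ?_
  rw [← hfix L fun _ h => h]
  have h := congrArg f hv
  rw [map_zero, map_list_prod, List.map_map] at h
  have hfun : (fun β : Word P => α.eval V - β.eval V) =
      f ∘ fun β => α.eval (LiAlgebra.v (P := P)) - β.eval LiAlgebra.v := by
    funext β
    rw [Function.comp_apply, map_sub, Word.map_eval, Word.map_eval, funext hf]
  rw [hfun, h, zero_apply]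

end Independence

/-! ### Assembly of the isomorphism and of `Λ`. -/

theorem mainTheorem8 {G : Type*} [Group G] (P : Submonoid G) :
    (∃ Φ : SharpAlgebra P ≃⋆ₐ[ℂ] LiAlgebra P, ∀ p : P, Φ (SharpAlgebra.w p) = LiAlgebra.v p) ∧
    ∃ Λ : LiAlgebra P →⋆ₐ[ℂ] UniversalToeplitzAlgebra P,
      (∀ p : P, Λ (LiAlgebra.v p) = UniversalToeplitzAlgebra.t p) ∧
      (∀ Λ' : LiAlgebra P →⋆ₐ[ℂ] UniversalToeplitzAlgebra P,
        (∀ p : P, Λ' (LiAlgebra.v p) = UniversalToeplitzAlgebra.t p) → Λ' = Λ) ∧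
      Function.Surjective Λ ∧
      (Function.Bijective Λ ↔ SatisfiesIndependence P) := by
  constructor
  · obtain ⟨f, hf⟩ := SharpAlgebra.exists_hom (LiAlgebra.isSharpFamily P)
    obtain ⟨g, hg⟩ := LiAlgebra.exists_hom (SharpAlgebra.isSharpFamily P)
    have hfg : f.comp g = StarAlgHom.id ℂ _ := LiAlgebra.hom_ext fun p => by
      rw [StarAlgHom.comp_apply, hg, hf]; rfl
    have hgf : g.comp f = StarAlgHom.id ℂ _ :=
      UniversalCStarAlgebra.hom_ext (sharpRel_bounded P) fun p => by
        change g (f (SharpAlgebra.w p)) = SharpAlgebra.w p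
        rw [hf, hg]
    exact ⟨StarAlgEquiv.ofStarAlgHom f g hgf hfg, hf⟩
  · obtain ⟨Λ, hΛ⟩ := LiAlgebra.exists_hom (UniversalToeplitzAlgebra.isSharpFamily P)
    have hsurj : Function.Surjective Λ := by
      obtain ⟨f, hf⟩ := SharpAlgebra.exists_hom (LiAlgebra.isSharpFamily P)
      refine Λ.surjective_of_denseRange ?_
      refine (UniversalCStarAlgebra.denseRange_mk (toeplitzRel_bounded P)).mono ?_
      -- The canonical map of the free star-algebra into `T_u(P)` factors through `Λ`, so the range
      -- of `Λ` contains its dense image.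
      have h : (Λ.comp f).comp (UniversalCStarAlgebra.mkHom (sharpRel_bounded P)) =
          UniversalCStarAlgebra.mkHom (toeplitzRel_bounded P) :=
        FreeStarAlgebra.hom_ext fun p => by
          change Λ (f (SharpAlgebra.w p)) = UniversalToeplitzAlgebra.t p
          rw [hf, hΛ]
      rintro _ ⟨a, rfl⟩
      exact ⟨_, DFunLike.congr_fun h a⟩
    refine ⟨Λ, hΛ, fun Λ' h => LiAlgebra.hom_ext fun p => by rw [h, hΛ], hsurj, ?_⟩
    refine ⟨fun h => satisfiesIndependence_of_injective Λ hΛ h.1, fun hP => ⟨?_, hsurj⟩⟩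
    -- Under independence the `v_p` satisfy (T4) as well, which gives the left inverse `t_p ↦ v_p`
    -- of `Λ`.
    obtain ⟨g, hg⟩ := UniversalCStarAlgebra.exists_lift (toeplitzRel_bounded P) LiAlgebra.v
      ((LiAlgebra.isSharpFamily P).lift_eq_of_independence hP)
    have hgΛ : g.comp Λ = StarAlgHom.id ℂ _ := LiAlgebra.hom_ext fun p => by
      rw [StarAlgHom.comp_apply, hΛ]
      exact hg p
    exact Function.LeftInverse.injective (g := g) fun a => DFunLike.congr_fun hgΛ a
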